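/- \textbf{Setting.} Fix $\sigma>0$. A combinatorial rising bandit problem has $K$ base arms, a finite family $\mathcal S\subseteq 2^{[K]}$ of super arms, and independent outcomes $X_i(n)$ ($i\in[K]$, $n\ge 1$), where $X_i(n)\in[0,1]$ is the outcome of the $n$-th pull of base arm $i$; it has mean $\mu_i(n)$ and $X_i(n)-\mu_i(n)$ is $\sigma^2$-sub-Gaussian. With $\gamma_i(n):=\mu_i(n+1)-\mu_i(n)$ the means are rising and concave: $\gamma_i(n)\ge 0$ and $\gamma_i(n+1)\le\gamma_i(n)$ for all $n\ge 1$. In each round $t$ the learner plays a super arm $S_t\in\mathcal S$, every $i\in S_t$ is pulled once more, the outcomes $X_i(N_{i,t})$, $i\in S_t$, are observed ($N_{i,t}$ is the number of pulls of $i$ up to and including round $t$), and the reward is $X_{S_t}(t)=\sum_{i\in S_t}X_i(N_{i,t})$. A policy $\pi$ selects $S_t$ measurably from the past super arms and observations and an internal random seed that is independent of the outcomes. The regret on the problem $\vec\mu$ over $T$ rounds is $$R_{\vec\mu}(\pi,T)=\sup_{\pi'}\mathbb E_{\vec\mu,\pi'}\Big[\sum_{t=1}^T X_{S_t}(t)\Big]-\mathbb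 E_{\vec\mu,\pi}\Big[\sum_{t=1}^T X_{S_t}(t)\Big],$$ the supremum being over all policies, which may depend on $\vec\mu$ and $T$. For $c,\kappa>0$ let $\mathcal A_{c}=\mathcal A_{c,\kappa}$ be the class of such problems with $$\gamma_i(n)\le \kappa\, n^{-c}\qquad\text{for all } i\in[K],\ n\ge 1 .$$ \textbf{Theorem.} Let $1<c<2$, $\kappa>0$ and $\sigma>0$. There is a constant $C>0$, depending only on $c,\kappa,\sigma$, such that for every $L\ge 1$ there are a number $K$ of base arms and a super arm family $\mathcal S\subseteq 2^{[K]}$ with maximal super arm size $\max_{S\in\mathcal S}|S|=L$ such that, for every $T\ge 1$, every policy $\pi$ (which may be tuned to $\mathcal S$, $T$, $L$, $c$, $\kappa$, $\sigma$) has a problem $\vec\mu\in\mathcal A_{c,\kappa}$ with these $K$ and $\mathcal S$ for which $$R_{\vec\mu}(\pi,T)\ \ge\ C\,\max\big\{L\sqrt T,\ L\,T^{2-c}\big\}.$$ In particular $\inf_\pi\sup_{\vec\mu\in\mathcal A_{c,\kappa}}R_{\vec\mu}(\pi,T)\ge C\max\{L\sqrt T,\,LT^{2-c}\}$. -/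

import Mathlib

open MeasureTheory ProbabilityTheory
open scoped NNReal

namespace RisingBandit

/-- A rising bandit problem with `K` base arms and noise level `σ`.
`law i n` is the law of the outcome `X_i(n)` that base arm `i` yields when it is pulled for the
`n`-th time, `n = 1, 2, 3, …` (the index `n = 0` is never used).  Outcomes lie in `[0, 1]`, are
`σ ^ 2`-sub-Gaussian around their mean, and the means are nondecreasing and concave in `n ≥ 1`. -/
structure Problem (K : ℕ) (σ : ℝ≥0) where
  law : Fin K → ℕ → Measure ℝ
  isProb : ∀ i n, IsProbabilityMeasure (law i n)
  bounded : ∀ i n, ∀ᵐ x ∂(law i n), x ∈ Set.Icc (0 : ℝ) 1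
  subgaussian : ∀ i n, HasSubgaussianMGF (fun x => x - ∫ y, y ∂(law i n)) (σ ^ 2) (law i n)
  rising : ∀ i n, 1 ≤ n → ∫ x, x ∂(law i n) ≤ ∫ x, x ∂(law i (n + 1))
  concave : ∀ i n, 1 ≤ n →
    (∫ x, x ∂(law i (n + 2))) - (∫ x, x ∂(law i (n + 1)))
      ≤ (∫ x, x ∂(law i (n + 1))) - (∫ x, x ∂(law i n))

attribute [instance] Problem.isProb

variable {K : ℕ} {σ : ℝ≥0}

/-- `μ_i(n)`, the mean outcome of the `n`-th pull of base arm `i`. -/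
noncomputable def Problem.mean (B : Problem K σ) (i : Fin K) (n : ℕ) : ℝ :=
  ∫ x, x ∂(B.law i n)

/-- `γ_i(n) = μ_i(n+1) - μ_i(n)`. -/
noncomputable def Problem.increment (B : Problem K σ) (i : Fin K) (n : ℕ) : ℝ :=
  B.mean i (n + 1) - B.mean i n

/-- The constrained class: all increments satisfy `γ_i(n) ≤ κ n^{-c}`, `n ≥ 1`. -/
def constrainedClass (K : ℕ) (σ : ℝ≥0) (c κ : ℝ) : Set (Problem K σ) :=
  {B | ∀ i n, 1 ≤ n → B.increment i n ≤ κ * (n : ℝ) ^ (-c)}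

/-- The joint law of the outcomes `X_i(n)`, which are independent over `i` and `n`. -/
noncomputable def Problem.outcomeLaw (B : Problem K σ) : Measure (Fin K × ℕ → ℝ) :=
  Measure.infinitePi fun p : Fin K × ℕ => B.law p.1 p.2

/-- A (randomized, history dependent) policy for the super arm family `𝒮`.  In round `t`
(rounds are numbered from `0`) it picks a super arm as a measurable function of an internal random
seed, of the super arms `a s` played in the rounds `s < t`, and of the outcomes `y s i` observed in
these rounds (semi-bandit feedback: `y s i` is the outcome of arm `i` if `i ∈ a s`, and is set to
`0`, carrying no information, otherwise). -/
structure Policy (K : ℕ) (𝒮 : Finset (Finset (Fin K))) where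
  seedLaw : Measure ℝ
  isProb : IsProbabilityMeasure seedLaw
  choose : (t : ℕ) → ℝ → (Fin t → Finset (Fin K)) → (Fin t → Fin K → ℝ) → Finset (Fin K)
  choose_mem : ∀ t u a y, choose t u a y ∈ 𝒮
  choose_measurable : ∀ (t : ℕ) (a : Fin t → Finset (Fin K)) (S : Finset (Fin K)),
    MeasurableSet {p : ℝ × (Fin t → Fin K → ℝ) | choose t p.1 a p.2 = S}

attribute [instance] Policy.isProb

variable {𝒮 : Finset (Finset (Fin K))}

/-- How often base arm `i` occurs among the super arms `a 0, …, a (t-1)`. -/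
def pullCount {t : ℕ} (a : Fin t → Finset (Fin K)) (i : Fin K) : ℕ :=
  (Finset.univ.filter fun s => i ∈ a s).card

/-- What is observed when super arm `S` is played after the super arms `a`, the outcomes being
given by the table `x`: every `i ∈ S` yields the outcome of its next pull. -/
def observe {t : ℕ} (x : Fin K × ℕ → ℝ) (a : Fin t → Finset (Fin K)) (S : Finset (Fin K))
    (i : Fin K) : ℝ :=
  if i ∈ S then x (i, pullCount a i + 1) else 0

/-- The super arms played and the outcomes observed in the first `t` rounds, when the policy has
seed `u` and the outcome table is `x`. -/
def Policy.history (π : Policy K 𝒮) (u : ℝ) (x : Fin K × ℕ → ℝ) :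
    (t : ℕ) → (Fin t → Finset (Fin K)) × (Fin t → Fin K → ℝ)
  | 0 => (Fin.elim0, Fin.elim0)
  | t + 1 =>
    let h := π.history u x t
    let S := π.choose t u h.1 h.2
    (Fin.snoc (α := fun _ => Finset (Fin K)) h.1 S,
      Fin.snoc (α := fun _ => Fin K → ℝ) h.2 (observe x h.1 S))

/-- The reward collected in the first `T` rounds: each round pays the sum of the outcomes of the
base arms in the super arm played. -/
def Policy.totalReward (π : Policy K 𝒮) (u : ℝ) (x : Fin K × ℕ → ℝ) (T : ℕ) : ℝ :=
  ∑ t : Fin T, ∑ i ∈ (π.history u x T).1 t, (π.history u x T).2 t i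

/-- The expected cumulative reward of `π` on `B` over `T` rounds. -/
noncomputable def Policy.expectedReward (π : Policy K 𝒮) (B : Problem K σ) (T : ℕ) : ℝ :=
  ∫ p, π.totalReward p.1 p.2 T ∂(π.seedLaw.prod B.outcomeLaw)

/-- The optimal expected cumulative reward over all policies for `𝒮` (which may be tuned to
`B` and `T`). -/
noncomputable def optimalReward (𝒮 : Finset (Finset (Fin K))) (B : Problem K σ) (T : ℕ) : ℝ :=
  ⨆ π : Policy K 𝒮, π.expectedReward B T

/-- The regret `R_B(π, T)`. -/
noncomputable def Policy.regret (π : Policy K 𝒮) (B : Problem K σ) (T : ℕ) : ℝ :=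
  optimalReward 𝒮 B T - π.expectedReward B T

end RisingBandit

namespace RisingBandit

variable {K : ℕ} {σ : ℝ≥0} {𝒮 : Finset (Finset (Fin K))}

/-! The family offers two base arms at each of `L` positions, and a super arm takes one of them at
every position, so `K = 2L`. Arm `0` has a fixed constant mean. Arm `1` at position `j` is worse or
better than it according to a bit `v j`. If every wrong choice at a position costs `δ` on average,
and flipping one bit forces at least `r` expected wrong choices in the two problems together, then
averaging over the hypercube of bits yields a problem with regret at least `L * δ * r / 2`
(`exists_regret_ge`).

For the `T ^ (2 - c)` term there is no noise. Arm `1` climbs with slope `s ≈ T ^ (-c)`, either up to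
pull `T` or only up to pull `T / 4`. The two cases look alike for `T / 4` pulls and a mistake costs
order `s * T` per round, so each position loses order `s * T ^ 2`.

For the `√T` term the arms are stationary. Arm `1` has a two-point law tilted up or down by `ε ≈ 1 /
√T`; `T` samples cannot identify the sign reliably (`testing_lower_bound`), so each position loses
order `ε * T`.

Wald's identity (`Policy.expectedReward_eq`) reduces rewards to pull counts and means. The optimum
is bounded below by the policy that always plays the right super arm. -/

theorem measurable_fin_snoc {α β : Type*} [MeasurableSpace α] [MeasurableSpace β] {t : ℕ}
    {f : α → Fin t → β} {g : α → β} (hf : Measurable f) (hg : Measurable g) :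
    Measurable fun p => (Fin.snoc (α := fun _ => β) (f p) (g p) : Fin (t + 1) → β) := by
  rw [measurable_pi_iff]
  intro k
  refine Fin.lastCases ?_ (fun k => ?_) k
  · simpa using hg
  · simpa [Function.comp_def] using (measurable_pi_apply k).comp hf

theorem pullCount_snoc {t : ℕ} (a : Fin t → Finset (Fin K)) (S : Finset (Fin K)) (i : Fin K) :
    pullCount (Fin.snoc (α := fun _ => Finset (Fin K)) a S : Fin (t + 1) → Finset (Fin K)) i
      = pullCount a i + if i ∈ S then 1 else 0 := by
  simp only [pullCount, Finset.card_filter, Fin.sum_univ_castSucc, Fin.snoc_castSucc,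
    Fin.snoc_last]

/-! ### Dynamics of a policy: pull counts, dependence on observed outcomes, measurability. -/

namespace Policy

/-- The super arm played in round `t`. -/
def play (π : Policy K 𝒮) (u : ℝ) (x : Fin K × ℕ → ℝ) (t : ℕ) : Finset (Fin K) :=
  π.choose t u (π.history u x t).1 (π.history u x t).2

/-- The number of pulls of base arm `i` in the first `t` rounds. -/
def pulls (π : Policy K 𝒮) (u : ℝ) (x : Fin K × ℕ → ℝ) (t : ℕ) (i : Fin K) : ℕ :=
  pullCount (π.history u x t).1 i

variable (π : Policy K 𝒮)

theorem play_mem (u : ℝ) (x : Fin K × ℕ → ℝ) (t : ℕ) : π.play u x t ∈ 𝒮 :=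
  π.choose_mem _ _ _ _

theorem history_succ (u : ℝ) (x : Fin K × ℕ → ℝ) (t : ℕ) :
    π.history u x (t + 1) =
      (Fin.snoc (α := fun _ => Finset (Fin K)) (π.history u x t).1 (π.play u x t),
        Fin.snoc (α := fun _ => Fin K → ℝ) (π.history u x t).2
          (observe x (π.history u x t).1 (π.play u x t))) := rfl

@[simp] theorem pulls_zero (u : ℝ) (x : Fin K × ℕ → ℝ) (i : Fin K) : π.pulls u x 0 i = 0 := by
  simp [pulls, pullCount]

theorem pulls_succ (u : ℝ) (x : Fin K × ℕ → ℝ) (t : ℕ) (i : Fin K) :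
    π.pulls u x (t + 1) i = π.pulls u x t i + if i ∈ π.play u x t then 1 else 0 := by
  simp only [pulls, history_succ, pullCount_snoc]

theorem pulls_le (u : ℝ) (x : Fin K × ℕ → ℝ) (t : ℕ) (i : Fin K) : π.pulls u x t i ≤ t := by
  induction t with
  | zero => simp
  | succ t ih => rw [pulls_succ]; split_ifs <;> omega

theorem totalReward_succ (u : ℝ) (x : Fin K × ℕ → ℝ) (T : ℕ) :
    π.totalReward u x (T + 1) = π.totalReward u x T +
      ∑ i ∈ π.play u x T, x (i, π.pulls u x T i + 1) := by
  simp only [totalReward, history_succ, Fin.sum_univ_castSucc, Fin.snoc_castSucc, Fin.snoc_last,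
    observe, pulls]
  congr 1
  exact Finset.sum_congr rfl fun i hi => by simp [hi]

@[simp] theorem totalReward_zero (u : ℝ) (x : Fin K × ℕ → ℝ) : π.totalReward u x 0 = 0 := by
  simp [totalReward]

/-- The history only depends on the outcomes that have been observed. -/
theorem history_congr (u : ℝ) {x x' : Fin K × ℕ → ℝ} (t : ℕ)
    (h : ∀ i n, n < π.pulls u x t i → x (i, n + 1) = x' (i, n + 1)) :
    π.history u x t = π.history u x' t := by
  induction t with
  | zero => rfl
  | succ t ih =>
    have e := ih fun i n hn => h i n (by rw [pulls_succ]; omega)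
    have ep : π.play u x t = π.play u x' t := by simp only [play, e]
    rw [history_succ, history_succ, ← ep, ← e]
    congr 2
    funext i
    simp only [observe]
    split_ifs with hi
    · refine h i _ ?_
      rw [pulls_succ, if_pos hi]
      exact Nat.lt_succ_self _
    · rfl

theorem play_congr (u : ℝ) {x x' : Fin K × ℕ → ℝ} (t : ℕ)
    (h : ∀ i n, n < π.pulls u x t i → x (i, n + 1) = x' (i, n + 1)) :
    π.play u x t = π.play u x' t := by
  simp only [play, π.history_congr u t h]

theorem pulls_congr (u : ℝ) {x x' : Fin K × ℕ → ℝ} (t : ℕ)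
    (h : ∀ i n, n < π.pulls u x t i → x (i, n + 1) = x' (i, n + 1)) (i : Fin K) :
    π.pulls u x t i = π.pulls u x' t i := by
  simp only [pulls, π.history_congr u t h]

/-- Super arm histories form a finite type, so it suffices to check each slice with the history
fixed. -/
theorem measurable_choose (t : ℕ) : Measurable
    fun p : (ℝ × (Fin t → Fin K → ℝ)) × (Fin t → Finset (Fin K)) =>
      π.choose t p.1.1 p.2 p.1.2 :=
  measurable_from_prod_countable_left fun a =>
    measurable_to_countable' fun S => π.choose_measurable t a S

theorem measurable_history (t : ℕ) :
    Measurable fun p : ℝ × (Fin K × ℕ → ℝ) => π.history p.1 p.2 t := by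
  induction t with
  | zero => exact measurable_const
  | succ t ih =>
    have hp : Measurable fun p : ℝ × (Fin K × ℕ → ℝ) => π.play p.1 p.2 t :=
      (π.measurable_choose t).comp ((measurable_fst.prodMk ih.snd).prodMk ih.fst)
    have ho : Measurable fun q : (Fin K × ℕ → ℝ) × ((Fin t → Finset (Fin K)) × Finset (Fin K)) =>
        observe q.1 q.2.1 q.2.2 := by
      refine measurable_from_prod_countable_left fun y => ?_
      rw [measurable_pi_iff]
      intro i
      simp only [observe]
      split_ifs
      · exact measurable_pi_apply _
      · exact measurable_const
    simp only [history_succ]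
    exact (measurable_fin_snoc ih.fst hp).prodMk
      (measurable_fin_snoc ih.snd (ho.comp (measurable_snd.prodMk (ih.fst.prodMk hp))))

theorem measurable_play (t : ℕ) :
    Measurable fun p : ℝ × (Fin K × ℕ → ℝ) => π.play p.1 p.2 t :=
  (π.measurable_choose t).comp
    ((measurable_fst.prodMk (π.measurable_history t).snd).prodMk (π.measurable_history t).fst)

theorem measurable_pulls (t : ℕ) (i : Fin K) :
    Measurable fun p : ℝ × (Fin K × ℕ → ℝ) => π.pulls p.1 p.2 t i :=
  (measurable_of_countable fun a : Fin t → Finset (Fin K) => pullCount a i).comp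
    (π.measurable_history t).fst

/-- The random index `pulls + 1` is traded for indicators times fixed coordinates of the table, the
form to which independence applies. -/
theorem sum_play_eq (u : ℝ) (x : Fin K × ℕ → ℝ) (t : ℕ) (f : Fin K × ℕ → ℝ) :
    ∑ i ∈ π.play u x t, f (i, π.pulls u x t i + 1) =
      ∑ i, ∑ n ∈ Finset.range (t + 1),
        if i ∈ π.play u x t ∧ π.pulls u x t i = n then f (i, n + 1) else 0 := by
  have : ∑ i ∈ π.play u x t, f (i, π.pulls u x t i + 1) =
      ∑ i, if i ∈ π.play u x t then f (i, π.pulls u x t i + 1) else 0 := by simp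
  rw [this]
  refine Finset.sum_congr rfl fun i _ => ?_
  by_cases hi : i ∈ π.play u x t
  · simp [hi, Nat.lt_succ_of_le (π.pulls_le u x t i)]
  · simp [hi]

/-- The sum of a table along the pulls made in the first `t` rounds. -/
theorem sum_pulls_succ (u : ℝ) (x : Fin K × ℕ → ℝ) (t : ℕ) (f : Fin K × ℕ → ℝ) :
    ∑ i, ∑ n ∈ Finset.range (π.pulls u x (t + 1) i), f (i, n + 1) =
      ∑ i, ∑ n ∈ Finset.range (π.pulls u x t i), f (i, n + 1) +
        ∑ i ∈ π.play u x t, f (i, π.pulls u x t i + 1) := by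
  have : ∑ i ∈ π.play u x t, f (i, π.pulls u x t i + 1) =
      ∑ i, if i ∈ π.play u x t then f (i, π.pulls u x t i + 1) else 0 := by simp
  rw [this, ← Finset.sum_add_distrib]
  refine Finset.sum_congr rfl fun i _ => ?_
  rw [pulls_succ]
  split_ifs <;> simp [Finset.sum_range_succ]

theorem totalReward_eq (u : ℝ) (x : Fin K × ℕ → ℝ) (T : ℕ) :
    π.totalReward u x T = ∑ i, ∑ n ∈ Finset.range (π.pulls u x T i), x (i, n + 1) := by
  induction T with
  | zero => simp
  | succ T ih => rw [totalReward_succ, ih, π.sum_pulls_succ u x T x]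

end Policy

/-! ### Resampling one coordinate, and Wald's identity. -/

theorem measurable_update_prod {ι : Type*} [DecidableEq ι] {X : ι → Type*}
    [∀ i, MeasurableSpace (X i)] (p : ι) :
    Measurable fun q : (∀ i, X i) × X p => Function.update q.1 p q.2 := by
  rw [measurable_pi_iff]
  intro i
  by_cases h : i = p
  · subst h; simpa using measurable_snd
  · simpa [Function.update_of_ne h, Function.comp_def] using
      (measurable_pi_apply i).comp measurable_fst

/-- Resampling one coordinate does not change a product law. -/
theorem infinitePi_map_update {ι : Type*} [DecidableEq ι] {X : ι → Type*}
    [∀ i, MeasurableSpace (X i)] (μ : ∀ i, Measure (X i)) [∀ i, IsProbabilityMeasure (μ i)]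
    (p : ι) :
    ((Measure.infinitePi μ).prod (μ p)).map (fun q => Function.update q.1 p q.2)
      = Measure.infinitePi μ := by
  have hm := measurable_update_prod (X := X) p
  refine Measure.eq_infinitePi _ fun s t ht => ?_
  rw [Measure.map_apply hm (.pi s.countable_toSet fun _ _ => ht _)]
  have : (fun q : (∀ i, X i) × X p => Function.update q.1 p q.2) ⁻¹' (s : Set ι).pi t =
      ((s.erase p : Finset ι) : Set ι).pi t ×ˢ (if p ∈ s then t p else Set.univ) := by
    ext q
    simp only [Set.mem_preimage, Set.mem_pi, Set.mem_prod, Finset.coe_erase]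
    constructor
    · refine fun h => ⟨fun i hi => ?_, ?_⟩
      · simpa [Function.update_of_ne (show i ≠ p by simpa using hi.2)] using h i hi.1
      · split_ifs with hp
        · simpa using h p hp
        · trivial
    · rintro ⟨h1, h2⟩ i hi
      by_cases h : i = p
      · subst h
        simpa [show i ∈ s from hi] using h2
      · simpa [Function.update_of_ne h] using h1 i ⟨hi, h⟩
  rw [this, Measure.prod_prod, Measure.infinitePi_pi _ fun i _ => ht i]
  split_ifs with hp
  · rw [Finset.prod_erase_mul _ _ hp]
  · rw [Finset.erase_eq_of_notMem hp]; simp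

/-- A function that ignores coordinate `p` is uncorrelated with coordinate `p`. -/
theorem integral_mul_eval_infinitePi {ι : Type*} [DecidableEq ι] (μ : ι → Measure ℝ)
    [∀ i, IsProbabilityMeasure (μ i)] (p : ι) {g : (ι → ℝ) → ℝ} (hg : Measurable g)
    (hp : ∀ x y, g (Function.update x p y) = g x) :
    ∫ x, g x * x p ∂(Measure.infinitePi μ) =
      ∫ x, g x * (∫ y, y ∂(μ p)) ∂(Measure.infinitePi μ) := by
  have hm := measurable_update_prod (X := fun _ : ι => ℝ) p
  -- After resampling coordinate `p`, `g` still depends on the old table only, so the integral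
  -- factors by Fubini.
  conv_lhs => rw [← infinitePi_map_update μ p]
  rw [integral_map hm.aemeasurable (by fun_prop)]
  simp only [hp, Function.update_self]
  rw [integral_prod_mul (f := g) (g := fun y => y), integral_mul_const]

theorem Problem.ae_outcome_mem (B : Problem K σ) :
    ∀ᵐ x ∂B.outcomeLaw, ∀ p, x p ∈ Set.Icc (0 : ℝ) 1 := by
  rw [ae_all_iff]
  intro p
  exact (measurePreserving_eval_infinitePi (fun p : Fin K × ℕ => B.law p.1 p.2)
    p).quasiMeasurePreserving.ae (B.bounded p.1 p.2)

instance (B : Problem K σ) : IsProbabilityMeasure B.outcomeLaw := by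
  unfold Problem.outcomeLaw; infer_instance

theorem Problem.mean_mem (B : Problem K σ) (i : Fin K) (n : ℕ) :
    B.mean i n ∈ Set.Icc (0 : ℝ) 1 := by
  have hi : Integrable (fun x : ℝ => x) (B.law i n) :=
    Integrable.of_mem_Icc 0 1 measurable_id.aemeasurable (B.bounded i n)
  constructor
  · exact integral_nonneg_of_ae ((B.bounded i n).mono fun x hx => hx.1)
  · calc B.mean i n ≤ ∫ _, (1 : ℝ) ∂(B.law i n) :=
        integral_mono_ae hi (integrable_const _) ((B.bounded i n).mono fun x hx => hx.2)
      _ = 1 := by simp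

namespace Policy

variable (π : Policy K 𝒮)

theorem sum_pulls_eq (u : ℝ) (x : Fin K × ℕ → ℝ) (T : ℕ) (f : Fin K × ℕ → ℝ) :
    ∑ i, ∑ n ∈ Finset.range (π.pulls u x T i), f (i, n + 1) =
      ∑ t ∈ Finset.range T, ∑ i, ∑ n ∈ Finset.range (t + 1),
        (if i ∈ π.play u x t ∧ π.pulls u x t i = n then 1 else 0) * f (i, n + 1) := by
  induction T with
  | zero => simp
  | succ T ih =>
    rw [sum_pulls_succ, ih, Finset.sum_range_succ, sum_play_eq]
    simp only [ite_mul, one_mul, zero_mul]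

/-- Whether the pull number `n + 1` of arm `i` happens in round `t` does not depend on its
outcome. -/
theorem indicator_pull_update (u : ℝ) (x : Fin K × ℕ → ℝ) (t : ℕ) (i : Fin K) (n : ℕ) (y : ℝ) :
    (if i ∈ π.play u (Function.update x (i, n + 1) y) t ∧
        π.pulls u (Function.update x (i, n + 1) y) t i = n then (1 : ℝ) else 0) =
      if i ∈ π.play u x t ∧ π.pulls u x t i = n then 1 else 0 := by
  have key : ∀ x x' : Fin K × ℕ → ℝ, (∀ p, p ≠ (i, n + 1) → x p = x' p) →
      i ∈ π.play u x t ∧ π.pulls u x t i = n → i ∈ π.play u x' t ∧ π.pulls u x' t i = n := by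
    intro x x' h hx
    have ha : ∀ i' n', n' < π.pulls u x t i' → x (i', n' + 1) = x' (i', n' + 1) := by
      intro i' n' hn'
      -- With exactly `n` pulls of `i` made so far, the outcome at `(i, n + 1)` has not been
      -- observed yet.
      refine h _ fun e => ?_
      obtain ⟨rfl, e2⟩ := Prod.mk.inj e
      omega
    rwa [← π.play_congr u t ha, ← π.pulls_congr u t ha]
  exact if_congr ⟨key _ _ fun p hp => by simp [Function.update_of_ne hp],
    key _ _ fun p hp => by simp [Function.update_of_ne hp]⟩ rfl rfl

theorem measurable_indicator_pull (t : ℕ) (i : Fin K) (n : ℕ) :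
    Measurable fun p : ℝ × (Fin K × ℕ → ℝ) =>
      if i ∈ π.play p.1 p.2 t ∧ π.pulls p.1 p.2 t i = n then (1 : ℝ) else 0 := by
  refine Measurable.ite ?_ measurable_const measurable_const
  exact (((measurable_finset_mem i).comp (π.measurable_play t)).setOf).inter
    (π.measurable_pulls t i (measurableSet_singleton n))

theorem integrable_pulls (P : Measure (ℝ × (Fin K × ℕ → ℝ))) [IsFiniteMeasure P] (T : ℕ)
    (i : Fin K) (φ : ℕ → ℝ) : Integrable (fun p => φ (π.pulls p.1 p.2 T i)) P := by
  refine Integrable.of_bound ((measurable_of_countable φ).comp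
    (π.measurable_pulls T i)).aestronglyMeasurable (∑ k ∈ Finset.range (T + 1), |φ k|) ?_
  refine Filter.Eventually.of_forall fun p => ?_
  exact Finset.single_le_sum (f := fun k => |φ k|) (fun _ _ => abs_nonneg _)
    (Finset.mem_range.2 (Nat.lt_succ_of_le (π.pulls_le p.1 p.2 T i)))

/-- Wald's identity: in expectation, every pull pays its mean. -/
theorem expectedReward_eq (B : Problem K σ) (T : ℕ) :
    π.expectedReward B T = ∑ i, ∫ p, ∑ n ∈ Finset.range (π.pulls p.1 p.2 T i), B.mean i (n + 1)
      ∂(π.seedLaw.prod B.outcomeLaw) := by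
  have hx : ∀ t i n, Integrable (fun p : ℝ × (Fin K × ℕ → ℝ) =>
      (if i ∈ π.play p.1 p.2 t ∧ π.pulls p.1 p.2 t i = n then (1 : ℝ) else 0) * p.2 (i, n + 1))
      (π.seedLaw.prod B.outcomeLaw) := by
    intro t i n
    refine Integrable.of_bound ((π.measurable_indicator_pull t i n).mul
      ((measurable_pi_apply _).comp measurable_snd)).aestronglyMeasurable 1 ?_
    have := (Measure.quasiMeasurePreserving_snd (μ := π.seedLaw) (ν := B.outcomeLaw)).ae
      B.ae_outcome_mem
    filter_upwards [this] with p hp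
    rw [Real.norm_eq_abs, abs_le]
    have := hp (i, n + 1)
    split_ifs <;> constructor <;> simp <;> linarith [this.1, this.2]
  have hm : ∀ t i n, Integrable (fun p : ℝ × (Fin K × ℕ → ℝ) =>
      (if i ∈ π.play p.1 p.2 t ∧ π.pulls p.1 p.2 t i = n then (1 : ℝ) else 0) * B.mean i (n + 1))
      (π.seedLaw.prod B.outcomeLaw) := by
    intro t i n
    refine Integrable.mul_const ?_ _
    refine Integrable.of_bound (π.measurable_indicator_pull t i n).aestronglyMeasurable 1 ?_
    refine Filter.Eventually.of_forall fun p => ?_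
    split_ifs <;> simp
  have e : ∀ (f : Fin K × ℕ → ℝ) (u : ℝ) (x : Fin K × ℕ → ℝ),
      ∑ i, ∑ n ∈ Finset.range (π.pulls u x T i), f (i, n + 1) = _ :=
    fun f u x => π.sum_pulls_eq u x T f
  rw [← integral_finsetSum _ fun i _ => π.integrable_pulls _ T i
    (fun k => ∑ n ∈ Finset.range k, B.mean i (n + 1))]
  simp only [expectedReward, totalReward_eq, fun p : ℝ × (Fin K × ℕ → ℝ) => e p.2 p.1 p.2,
    fun p : ℝ × (Fin K × ℕ → ℝ) => e (fun q => B.mean q.1 q.2) p.1 p.2]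
  have hI : ∀ {F : ℕ → Fin K → ℕ → ℝ × (Fin K × ℕ → ℝ) → ℝ},
      (∀ t i n, Integrable (F t i n) (π.seedLaw.prod B.outcomeLaw)) →
      ∫ p, ∑ t ∈ Finset.range T, ∑ i, ∑ n ∈ Finset.range (t + 1), F t i n p
        ∂(π.seedLaw.prod B.outcomeLaw) = ∑ t ∈ Finset.range T, ∑ i, ∑ n ∈ Finset.range (t + 1),
        ∫ p, F t i n p ∂(π.seedLaw.prod B.outcomeLaw) := by
    intro F hF
    rw [integral_finsetSum _ fun t _ => integrable_finsetSum _ fun i _ =>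
      integrable_finsetSum _ fun n _ => hF t i n]
    refine Finset.sum_congr rfl fun t _ => ?_
    rw [integral_finsetSum _ fun i _ => integrable_finsetSum _ fun n _ => hF t i n]
    exact Finset.sum_congr rfl fun i _ => integral_finsetSum _ fun n _ => hF t i n
  rw [hI hx, hI hm]
  refine Finset.sum_congr rfl fun t _ => Finset.sum_congr rfl fun i _ =>
    Finset.sum_congr rfl fun n _ => ?_
  rw [integral_prod _ (hx t i n), integral_prod _ (hm t i n)]
  refine integral_congr_ae (Filter.Eventually.of_forall fun u => ?_)
  -- For a fixed seed, the event that this pull occurs in round `t` ignores the outcome of the pull.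
  exact integral_mul_eval_infinitePi (fun p : Fin K × ℕ => B.law p.1 p.2) (i, n + 1)
    ((π.measurable_indicator_pull t i n).comp measurable_prodMk_left)
    (fun x y => π.indicator_pull_update u x t i n y)

/-- Makes the rewards bounded above, so that the real supremum in `optimalReward` is a genuine one.
-/
theorem expectedReward_le (B : Problem K σ) (T : ℕ) : π.expectedReward B T ≤ K * T := by
  rw [expectedReward_eq]
  calc _ ≤ ∑ _i : Fin K, (T : ℝ) := Finset.sum_le_sum fun i _ => ?_
    _ = K * T := by simp
  calc _ ≤ ∫ _, (T : ℝ) ∂(π.seedLaw.prod B.outcomeLaw) := by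
        refine integral_mono (π.integrable_pulls _ T i
          (fun k => ∑ n ∈ Finset.range k, B.mean i (n + 1))) (integrable_const _) fun p => ?_
        calc _ ≤ ∑ _n ∈ Finset.range (π.pulls p.1 p.2 T i), (1 : ℝ) :=
              Finset.sum_le_sum fun n _ => (B.mean_mem i _).2
          _ = π.pulls p.1 p.2 T i := by simp
          _ ≤ T := by exact_mod_cast π.pulls_le p.1 p.2 T i
    _ = T := by simp

/-! ### Constant policies as lower bounds for the optimum. -/

theorem expectedReward_le_optimalReward (B : Problem K σ) (T : ℕ) :
    π.expectedReward B T ≤ optimalReward 𝒮 B T :=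
  le_ciSup (f := fun π : Policy K 𝒮 => π.expectedReward B T)
    ⟨K * T, by rintro _ ⟨π', rfl⟩; exact π'.expectedReward_le B T⟩ π

/-- The policy that always plays `S`. -/
noncomputable def const (S : Finset (Fin K)) (hS : S ∈ 𝒮) : Policy K 𝒮 where
  seedLaw := Measure.dirac 0
  isProb := inferInstance
  choose _ _ _ _ := S
  choose_mem _ _ _ _ := hS
  choose_measurable _ _ _ := MeasurableSet.const _

theorem pulls_const {S : Finset (Fin K)} (hS : S ∈ 𝒮) (u : ℝ) (x : Fin K × ℕ → ℝ) (t : ℕ)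
    (i : Fin K) : (const S hS).pulls u x t i = if i ∈ S then t else 0 := by
  induction t with
  | zero => simp
  | succ t ih =>
    have : (const S hS).play u x t = S := rfl
    rw [pulls_succ, ih, this]
    split_ifs <;> rfl

theorem expectedReward_const {S : Finset (Fin K)} (hS : S ∈ 𝒮) (B : Problem K σ) (T : ℕ) :
    (const S hS).expectedReward B T = ∑ i ∈ S, ∑ n ∈ Finset.range T, B.mean i (n + 1) := by
  have : IsProbabilityMeasure (const S hS).seedLaw := (const S hS).isProb
  rw [expectedReward_eq, ← Finset.sum_filter_add_sum_filter_not Finset.univ (· ∈ S),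
    Finset.sum_eq_zero (s := Finset.univ.filter fun i => i ∉ S), add_zero]
  · have : Finset.univ.filter (· ∈ S) = S := by ext; simp
    rw [this]
    exact Finset.sum_congr rfl fun i hi => by simp [pulls_const, hi]
  · intro i hi
    simp [pulls_const, (Finset.mem_filter.1 hi).2]

end Policy

/-! ### The choice family and averaging over the hypercube. -/

/-- The base arm with number `b` at position `j`. -/
def arm {L : ℕ} (j : Fin L) (b : Fin 2) : Fin (L * 2) := finProdFinEquiv (j, b)

/-- The super arm that takes the base arm `f j` at each position `j`. -/
def choiceArm {L : ℕ} (f : Fin L → Fin 2) : Finset (Fin (L * 2)) :=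
  Finset.univ.image fun j => arm j (f j)

/-- The super arms that take one of two base arms at each of `L` positions. -/
def choiceFamily (L : ℕ) : Finset (Finset (Fin (L * 2))) :=
  Finset.univ.image choiceArm

theorem arm_inj {L : ℕ} {j j' : Fin L} {b b' : Fin 2} : arm j b = arm j' b' ↔ j = j' ∧ b = b' := by
  simp [arm]

theorem arm_mem_choiceArm {L : ℕ} (f : Fin L → Fin 2) (j : Fin L) (b : Fin 2) :
    arm j b ∈ choiceArm f ↔ b = f j := by
  simp only [choiceArm, Finset.mem_image, Finset.mem_univ, true_and, arm_inj]
  constructor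
  · rintro ⟨_, rfl, h⟩; exact h.symm
  · exact fun h => ⟨j, rfl, h.symm⟩

theorem choiceArm_mem {L : ℕ} (f : Fin L → Fin 2) : choiceArm f ∈ choiceFamily L :=
  Finset.mem_image_of_mem _ (Finset.mem_univ _)

theorem sum_choiceArm {L : ℕ} (f : Fin L → Fin 2) (g : Fin (L * 2) → ℝ) :
    ∑ i ∈ choiceArm f, g i = ∑ j, g (arm j (f j)) :=
  Finset.sum_image fun _ _ _ _ h => (arm_inj.1 h).1

theorem card_choiceArm {L : ℕ} (f : Fin L → Fin 2) : (choiceArm f).card = L := by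
  rw [choiceArm, Finset.card_image_of_injective _ fun _ _ h => (arm_inj.1 h).1]
  simp

theorem sum_arms {L : ℕ} (g : Fin (L * 2) → ℝ) : ∑ i, g i = ∑ j, (g (arm j 0) + g (arm j 1)) := by
  rw [← finProdFinEquiv.sum_comp, Fintype.sum_prod_type]
  exact Finset.sum_congr rfl fun j _ => Fin.sum_univ_two _

/-- Every super arm contains exactly one arm of each position; hence the count of arm `1` determines
that of arm `0`. -/
theorem pulls_add_pulls {L : ℕ} (π : Policy (L * 2) (choiceFamily L)) (u : ℝ)
    (x : Fin (L * 2) × ℕ → ℝ) (t : ℕ) (j : Fin L) :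
    π.pulls u x t (arm j 0) + π.pulls u x t (arm j 1) = t := by
  induction t with
  | zero => simp
  | succ t ih =>
    obtain ⟨f, -, hf⟩ := Finset.mem_image.1 (π.play_mem u x t)
    rw [Policy.pulls_succ, Policy.pulls_succ, ← hf]
    simp only [arm_mem_choiceArm]
    have : f j = 0 ∨ f j = 1 := by omega
    rcases this with h | h <;> simp [h] <;> omega

/-- The regret over positions, when at position `j` every pull of the wrong arm costs `δ`. -/
theorem sum_le_regret {L : ℕ} (π : Policy (L * 2) (choiceFamily L)) (B : Problem (L * 2) σ)
    (T : ℕ) (v : Fin L → Bool) (δ : ℝ)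
    (h : ∀ j, ∀ k ≤ T, δ * (if v j then (T : ℝ) - k else k) ≤
      ∑ n ∈ Finset.range T, B.mean (arm j (if v j then 1 else 0)) (n + 1) -
        (∑ n ∈ Finset.range (T - k), B.mean (arm j 0) (n + 1) +
          ∑ n ∈ Finset.range k, B.mean (arm j 1) (n + 1))) :
    δ * ∑ j, ∫ p, (if v j then (T : ℝ) - π.pulls p.1 p.2 T (arm j 1)
      else π.pulls p.1 p.2 T (arm j 1)) ∂(π.seedLaw.prod B.outcomeLaw) ≤ π.regret B T := by
  -- The comparator plays the right arm at every position in all rounds.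
  have hopt := (Policy.const _ (choiceArm_mem fun j => if v j then 1
    else 0)).expectedReward_le_optimalReward B T
  rw [Policy.expectedReward_const, sum_choiceArm] at hopt
  rw [Policy.regret, π.expectedReward_eq, sum_arms]
  refine le_trans ?_ (sub_le_sub_right hopt _)
  rw [← Finset.sum_sub_distrib, Finset.mul_sum]
  refine Finset.sum_le_sum fun j _ => ?_
  have h0 := π.integrable_pulls (π.seedLaw.prod B.outcomeLaw) T (arm j 0)
    (fun k => ∑ n ∈ Finset.range k, B.mean (arm j 0) (n + 1))
  have h1 := π.integrable_pulls (π.seedLaw.prod B.outcomeLaw) T (arm j 1)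
    (fun k => ∑ n ∈ Finset.range k, B.mean (arm j 1) (n + 1))
  have h2 := π.integrable_pulls (π.seedLaw.prod B.outcomeLaw) T (arm j 1)
    (fun k => if v j then (T : ℝ) - k else k)
  have h01 : Integrable (fun p : ℝ × (Fin (L * 2) × ℕ → ℝ) =>
      ∑ n ∈ Finset.range (π.pulls p.1 p.2 T (arm j 0)), B.mean (arm j 0) (n + 1) +
        ∑ n ∈ Finset.range (π.pulls p.1 p.2 T (arm j 1)), B.mean (arm j 1) (n + 1))
      (π.seedLaw.prod B.outcomeLaw) := h0.add h1
  rw [← integral_add h0 h1, ← integral_const_mul]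
  have hc : ∀ c : ℝ, c = ∫ _, c ∂(π.seedLaw.prod B.outcomeLaw) := by simp
  rw [hc (∑ n ∈ Finset.range T, _), ← integral_sub (integrable_const _) h01]
  refine integral_mono (h2.const_mul δ) ((integrable_const _).sub h01) fun p => ?_
  have e : π.pulls p.1 p.2 T (arm j 0) = T - π.pulls p.1 p.2 T (arm j 1) := by
    have := pulls_add_pulls π p.1 p.2 T j
    omega
  simpa [e] using h j _ (π.pulls_le p.1 p.2 T (arm j 1))

/-- Averaging over a hypercube of problems that are pairwise hard to tell apart. -/
theorem exists_regret_ge {L : ℕ} (π : Policy (L * 2) (choiceFamily L))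
    (B : (Fin L → Bool) → Problem (L * 2) σ) (T : ℕ) {δ r : ℝ} (hδ : 0 ≤ δ)
    (h : ∀ v j, ∀ k ≤ T, δ * (if v j then (T : ℝ) - k else k) ≤
      ∑ n ∈ Finset.range T, (B v).mean (arm j (if v j then 1 else 0)) (n + 1) -
        (∑ n ∈ Finset.range (T - k), (B v).mean (arm j 0) (n + 1) +
          ∑ n ∈ Finset.range k, (B v).mean (arm j 1) (n + 1)))
    (hr : ∀ v j, v j = false →
      r ≤ ∫ p, (π.pulls p.1 p.2 T (arm j 1) : ℝ) ∂(π.seedLaw.prod (B v).outcomeLaw) +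
        ∫ p, ((T : ℝ) - π.pulls p.1 p.2 T (arm j 1))
          ∂(π.seedLaw.prod (B (Function.update v j true)).outcomeLaw)) :
    ∃ v, L * (δ * r / 2) ≤ π.regret (B v) T := by
  set D : (Fin L → Bool) → Fin L → ℝ := fun v j =>
    ∫ p, (if v j then (T : ℝ) - π.pulls p.1 p.2 T (arm j 1)
      else π.pulls p.1 p.2 T (arm j 1)) ∂(π.seedLaw.prod (B v).outcomeLaw) with hD
  have hpair : ∀ v j, r ≤ D v j + D (Function.update v j (!v j)) j := by
    intro v j
    cases hv : v j
    · simpa [hD, hv] using hr v j hv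
    · have := hr (Function.update v j false) j (by simp)
      rw [Function.update_idem, ← hv, Function.update_eq_self] at this
      simpa [hD, hv, add_comm] using this
  -- Flipping bit `j` permutes the cube, so summing `hpair` over all vertices counts each `D v j`
  -- twice.
  have hflip : ∀ j, ∑ v, D (Function.update v j (!v j)) j = ∑ v, D v j := by
    intro j
    have hi : Function.Involutive fun v : Fin L → Bool => Function.update v j (!v j) := by
      intro v; simp
    exact Equiv.sum_comp hi.toPerm fun v => D v j
  have hsum : ∀ j, (Fintype.card (Fin L → Bool)) * (r / 2) ≤ ∑ v, D v j := by
    intro j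
    have : ∑ _v : Fin L → Bool, r ≤ ∑ v, (D v j + D (Function.update v j (!v j)) j) :=
      Finset.sum_le_sum fun v _ => hpair v j
    rw [Finset.sum_add_distrib, hflip, Finset.sum_const, Finset.card_univ, nsmul_eq_mul] at this
    linarith
  by_contra hcon
  push Not at hcon
  have h1 : ∑ v, π.regret (B v) T < ∑ _v : Fin L → Bool, (L * (δ * r / 2)) :=
    Finset.sum_lt_sum_of_nonempty Finset.univ_nonempty fun v _ => hcon v
  have h2 : ∑ v, δ * ∑ j, D v j ≤ ∑ v, π.regret (B v) T :=
    Finset.sum_le_sum fun v _ => sum_le_regret π (B v) T v δ (h v)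
  have h3 : ∑ _j : Fin L, (Fintype.card (Fin L → Bool)) * (r / 2) ≤ ∑ j, ∑ v, D v j :=
    Finset.sum_le_sum fun j _ => hsum j
  rw [← Finset.mul_sum, Finset.sum_comm] at h2
  have h4 := mul_le_mul_of_nonneg_left h3 hδ
  simp only [Finset.sum_const, Finset.card_univ, nsmul_eq_mul, Fintype.card_fin] at h1 h4
  nlinarith [h1, h2, h4]

/-! ### Change of measure on product spaces and a two-hypothesis test. -/

/-- Integrals of functions of finitely many coordinates only depend on the laws of these. -/
theorem integral_infinitePi_congr {ι : Type*} (μ μ' : ι → Measure ℝ)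
    [∀ i, IsProbabilityMeasure (μ i)] [∀ i, IsProbabilityMeasure (μ' i)] (I : Finset ι)
    (h : ∀ p ∈ I, μ p = μ' p) {f : (ι → ℝ) → ℝ} (hf : Measurable f)
    (hI : ∀ x y, (∀ p ∈ I, x p = y p) → f x = f y) :
    ∫ x, f x ∂(Measure.infinitePi μ) = ∫ x, f x ∂(Measure.infinitePi μ') := by
  classical
  set e : (I → ℝ) → ι → ℝ := fun y p => if hp : p ∈ I then y ⟨p, hp⟩ else 0 with he
  have hem : Measurable e := by
    rw [measurable_pi_iff]
    intro p
    simp only [he]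
    split_ifs
    · exact measurable_pi_apply _
    · exact measurable_const
  have hfe : ∀ x, f x = (f ∘ e) (I.restrict x) := fun x => hI _ _ fun p hp => by simp [he, hp]
  have hsm : StronglyMeasurable (f ∘ e) := (hf.comp hem).stronglyMeasurable
  simp only [hfe]
  rw [integral_restrict_infinitePi μ hsm.aestronglyMeasurable,
    integral_restrict_infinitePi μ' hsm.aestronglyMeasurable]
  congr 2
  funext p
  exact h p p.2

/-- Changing finitely many factors of a product law by a density. -/
theorem infinitePi_eq_withDensity {ι : Type*} [DecidableEq ι] (μ μ' : ι → Measure ℝ)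
    [∀ i, IsProbabilityMeasure (μ i)] [∀ i, IsProbabilityMeasure (μ' i)] (F : Finset ι)
    {d : ℝ → ENNReal} (hd : Measurable d) (hF : ∀ p ∈ F, μ' p = (μ p).withDensity d)
    (hFc : ∀ p ∉ F, μ' p = μ p) :
    Measure.infinitePi μ' = (Measure.infinitePi μ).withDensity fun x => ∏ p ∈ F, d (x p) := by
  refine (Measure.eq_infinitePi _ fun s t ht => ?_).symm
  -- Merges the density and the indicator of the box into one factor per coordinate, so that
  -- independence evaluates the integral over `F ∪ s`.
  set k : ι → ℝ → ENNReal := fun p y =>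
    (if p ∈ F then d y else 1) * (if p ∈ s then (t p).indicator 1 y else 1) with hk
  have hkm : ∀ p, Measurable (k p) := by
    intro p
    refine Measurable.mul ?_ ?_
    · split_ifs
      exacts [hd, measurable_const]
    · split_ifs
      exacts [measurable_one.indicator (ht p), measurable_const]
  have hbox : MeasurableSet ((s : Set ι).pi t) := .pi s.countable_toSet fun _ _ => ht _
  have hprod : ∀ x, ((s : Set ι).pi t).indicator (fun x => ∏ p ∈ F, d (x p)) x =
      ∏ p ∈ F ∪ s, k p (x p) := by
    intro x
    simp only [hk, Finset.prod_mul_distrib]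
    rw [Finset.prod_ite_mem, Finset.prod_ite_mem, Finset.union_inter_cancel_left,
      Finset.union_inter_cancel_right]
    by_cases hx : x ∈ (s : Set ι).pi t
    · rw [Set.indicator_of_mem hx, Finset.prod_eq_one (s := s), mul_one]
      intro p hp
      simp [hx p hp]
    · rw [Set.indicator_of_notMem hx]
      simp only [Set.mem_pi, not_forall] at hx
      obtain ⟨p, hp, hpx⟩ := hx
      rw [Finset.prod_eq_zero (i := p) (s := s) hp (by simp [hpx]), mul_zero]
  have hint : ∀ p, ∫⁻ y, k p y ∂(μ p) = if p ∈ s then μ' p (t p) else 1 := by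
    intro p
    by_cases hs : p ∈ s <;> by_cases hf : p ∈ F <;> simp only [hk, hs, hf, if_true, if_false,
      mul_one, one_mul]
    · rw [hF p hf, withDensity_apply _ (ht p), ← lintegral_indicator (ht p)]
      refine lintegral_congr fun y => ?_
      by_cases hy : y ∈ t p <;> simp [hy]
    · rw [hFc p hf, lintegral_indicator_one (ht p)]
    · rw [← setLIntegral_univ, ← withDensity_apply _ .univ, ← hF p hf, measure_univ]
    · simp
  rw [withDensity_apply _ hbox, ← lintegral_indicator hbox, lintegral_congr hprod,
    lintegral_prod_eq_prod_lintegral_of_indepFun (μ := Measure.infinitePi μ) (F ∪ s)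
      (fun p x => k p (x p))
      (iIndepFun_infinitePi hkm) fun p => (hkm p).comp (measurable_pi_apply p)]
  have : ∀ p, ∫⁻ x, k p (x p) ∂(Measure.infinitePi μ) = if p ∈ s then μ' p (t p) else 1 := by
    intro p
    rw [← hint p, ← (measurePreserving_eval_infinitePi μ p).lintegral_comp (hkm p)]
  simp only [this]
  rw [Finset.prod_ite_mem, Finset.union_inter_cancel_right]

/-- The right side is at least `min p q`, and `max p q * (1 - (p + q) / 4) ≤ 1` because `b * (1 - b
/ 4) ≤ 1`. The bound is made to be integrated: for likelihood ratios with constant product `p * q`,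
only the total masses of `p` and `q` remain. -/
theorem min_testing_bound {p q f : ℝ} (hp : 0 ≤ p) (hq : 0 ≤ q) (hf0 : 0 ≤ f) (hf1 : f ≤ 1) :
    p * q * (1 - (p + q) / 4) ≤ p * f + q * (1 - f) := by
  have key : ∀ a b : ℝ, 0 ≤ a → a ≤ b → a * b * (1 - (a + b) / 4) ≤ a := by
    intro a b ha hab
    have : b * (1 - (a + b) / 4) ≤ 1 := by
      nlinarith [sq_nonneg (b - 2), mul_nonneg ha (ha.trans hab)]
    calc a * b * (1 - (a + b) / 4) = a * (b * (1 - (a + b) / 4)) := by ring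
      _ ≤ a * 1 := mul_le_mul_of_nonneg_left this ha
      _ = a := mul_one a
  rcases le_total p q with h | h
  · nlinarith [key p q hp h, mul_nonneg (sub_nonneg.2 h) (sub_nonneg.2 hf1)]
  · nlinarith [key q p hq h, mul_nonneg (sub_nonneg.2 h) hf0]

/-- Two product laws whose finitely many differing factors have the densities `1 ± ε s` with
`s = ± 1` cannot be told apart: any test errs with probability at least `(1 - ε ^ 2) ^ n / 2`. -/
theorem testing_lower_bound {ι : Type*} [DecidableEq ι] (μ μm μp : ι → Measure ℝ)
    [∀ i, IsProbabilityMeasure (μ i)] [∀ i, IsProbabilityMeasure (μm i)]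
    [∀ i, IsProbabilityMeasure (μp i)] (F : Finset ι) {s : ℝ → ℝ} (hs : Measurable s)
    (hs1 : ∀ y, s y = 1 ∨ s y = -1) {ε : ℝ} (hε0 : 0 ≤ ε) (hε1 : ε ≤ 1)
    (hm : ∀ p ∈ F, μm p = (μ p).withDensity fun y => ENNReal.ofReal (1 - ε * s y))
    (hp : ∀ p ∈ F, μp p = (μ p).withDensity fun y => ENNReal.ofReal (1 + ε * s y))
    (hm' : ∀ p ∉ F, μm p = μ p) (hp' : ∀ p ∉ F, μp p = μ p)
    {f : (ι → ℝ) → ℝ} (hf : Measurable f) (hf0 : ∀ x, 0 ≤ f x) (hf1 : ∀ x, f x ≤ 1) :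
    (1 - ε ^ 2) ^ F.card / 2 ≤
      ∫ x, f x ∂(Measure.infinitePi μm) + ∫ x, (1 - f x) ∂(Measure.infinitePi μp) := by
  set P := Measure.infinitePi μ with hP
  -- The sign `τ` treats both tilts at once.
  have dens : ∀ (μ' : ι → Measure ℝ) [∀ i, IsProbabilityMeasure (μ' i)] (τ : ℝ), τ = 1 ∨ τ = -1 →
      (∀ p ∈ F, μ' p = (μ p).withDensity fun y => ENNReal.ofReal (1 + τ * ε * s y)) →
      (∀ p ∉ F, μ' p = μ p) →
      (∀ x : ι → ℝ, 0 ≤ ∏ p ∈ F, (1 + τ * ε * s (x p))) ∧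
      (∀ g : (ι → ℝ) → ℝ, ∫ x, g x ∂(Measure.infinitePi μ') =
        ∫ x, (∏ p ∈ F, (1 + τ * ε * s (x p))) * g x ∂P) ∧
      (∀ g : (ι → ℝ) → ℝ, Measurable g → (∀ x, 0 ≤ g x) → (∀ x, g x ≤ 1) →
        Integrable (fun x => (∏ p ∈ F, (1 + τ * ε * s (x p))) * g x) P) := by
    intro μ' _ τ hτ h1 h2
    have h0 : ∀ y, 0 ≤ 1 + τ * ε * s y := by
      intro y
      rcases hτ with rfl | rfl <;> rcases hs1 y with h | h <;> rw [h] <;> linarith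
    have h3 : ∀ y, 1 + τ * ε * s y ≤ 2 := by
      intro y
      rcases hτ with rfl | rfl <;> rcases hs1 y with h | h <;> rw [h] <;> linarith
    have hpos : ∀ x : ι → ℝ, 0 ≤ ∏ p ∈ F, (1 + τ * ε * s (x p)) :=
      fun x => Finset.prod_nonneg fun p _ => h0 _
    have hmeas : Measurable fun x : ι → ℝ => ∏ p ∈ F, (1 + τ * ε * s (x p)) := by fun_prop
    refine ⟨hpos, fun g => ?_, fun g hg hg0 hg1 => ?_⟩
    · have hd : Measurable fun y => ENNReal.ofReal (1 + τ * ε * s y) := by fun_prop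
      rw [infinitePi_eq_withDensity μ μ' F hd h1 h2]
      simp only [← ENNReal.ofReal_prod_of_nonneg fun p _ => h0 _]
      rw [integral_withDensity_eq_integral_toReal_smul hmeas.ennreal_ofReal
        (Filter.Eventually.of_forall fun _ => ENNReal.ofReal_lt_top)]
      simp only [ENNReal.toReal_ofReal (hpos _), smul_eq_mul, hP]
    · refine Integrable.of_bound (hmeas.mul hg).aestronglyMeasurable (2 ^ F.card)
        (Filter.Eventually.of_forall fun x => ?_)
      rw [Real.norm_eq_abs, abs_of_nonneg (mul_nonneg (hpos x) (hg0 x))]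
      calc _ ≤ (∏ p ∈ F, (1 + τ * ε * s (x p))) * 1 :=
            mul_le_mul_of_nonneg_left (hg1 x) (hpos x)
        _ ≤ ∏ _p ∈ F, (2 : ℝ) := by
            rw [mul_one]; exact Finset.prod_le_prod (fun p _ => h0 _) fun p _ => h3 _
        _ = 2 ^ F.card := by simp
  obtain ⟨m0, mI, mi⟩ := dens μm (-1) (Or.inr rfl)
    (fun p h => by rw [hm p h]; congr 1; funext y; congr 1; ring) hm'
  obtain ⟨p0, pI, pi⟩ := dens μp 1 (Or.inl rfl)
    (fun p h => by rw [hp p h]; congr 1; funext y; congr 1; ring) hp'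
  have m1 := mI fun _ => 1
  have p1 := pI fun _ => 1
  have hmi := mi (fun _ => 1) measurable_const (by simp) (by simp)
  have hpi := pi (fun _ => 1) measurable_const (by simp) (by simp)
  have hpf := pi (fun x => 1 - f x) (by fun_prop) (fun x => by linarith [hf1 x])
    (fun x => by linarith [hf0 x])
  simp only [mul_one, integral_const, probReal_univ, smul_eq_mul] at m1 p1 hmi hpi
  have hsum : Integrable (fun x : ι → ℝ => ((∏ p ∈ F, (1 + -1 * ε * s (x p))) +
      ∏ p ∈ F, (1 + 1 * ε * s (x p))) / 4) P := (hmi.add hpi).div_const 4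
  rw [mI, pI, ← integral_add (mi f hf hf0 hf1) hpf]
  -- Since `s ^ 2 = 1`, opposite tilts of a common base have a product of densities that is constant
  -- in `x`.
  have hpq : ∀ x : ι → ℝ, (∏ p ∈ F, (1 + -1 * ε * s (x p))) * ∏ p ∈ F, (1 + 1 * ε * s (x p)) =
      (1 - ε ^ 2) ^ F.card := by
    intro x
    rw [← Finset.prod_mul_distrib, ← Finset.prod_const]
    refine Finset.prod_congr rfl fun p _ => ?_
    rcases hs1 (x p) with h | h <;> rw [h] <;> ring
  calc (1 - ε ^ 2) ^ F.card / 2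
      = ∫ x, (1 - ε ^ 2) ^ F.card * (1 - ((∏ p ∈ F, (1 + -1 * ε * s (x p))) +
          ∏ p ∈ F, (1 + 1 * ε * s (x p))) / 4) ∂P := by
        -- Both densities have mass `1`, so the bracket integrates to `1 - 2 / 4 = 1 / 2`.
        rw [integral_const_mul, integral_sub (integrable_const _) hsum,
          integral_div, integral_add hmi hpi, ← m1, ← p1]
        simp
        ring
    _ ≤ _ := by
        refine integral_mono (((integrable_const _).sub hsum).const_mul _)
          ((mi f hf hf0 hf1).add hpf) fun x => ?_
        have := min_testing_bound (m0 x) (p0 x) (hf0 x) (hf1 x)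
        rw [hpq] at this
        exact this

/-! ### Assembling problems from single arms. -/

/-- The laws of the successive outcomes of a single rising base arm. -/
structure ArmLaw (σ : ℝ≥0) where
  law : ℕ → Measure ℝ
  isProb : ∀ n, IsProbabilityMeasure (law n)
  bounded : ∀ n, ∀ᵐ x ∂(law n), x ∈ Set.Icc (0 : ℝ) 1
  subgaussian : ∀ n, HasSubgaussianMGF (fun x => x - ∫ y, y ∂(law n)) (σ ^ 2) (law n)
  rising : ∀ n, 1 ≤ n → ∫ x, x ∂(law n) ≤ ∫ x, x ∂(law (n + 1))
  concave : ∀ n, 1 ≤ n → (∫ x, x ∂(law (n + 2))) - (∫ x, x ∂(law (n + 1)))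
      ≤ (∫ x, x ∂(law (n + 1))) - (∫ x, x ∂(law n))

attribute [instance] ArmLaw.isProb

/-- The problem with given base arms. -/
def Problem.ofArms (A : Fin K → ArmLaw σ) : Problem K σ where
  law i := (A i).law
  isProb i := (A i).isProb
  bounded i := (A i).bounded
  subgaussian i := (A i).subgaussian
  rising i := (A i).rising
  concave i := (A i).concave

/-- Hoeffding's lemma, with the variance proxy enlarged to `σ ^ 2`. -/
theorem hasSubgaussianMGF_of_mem_Icc_of_le {μ : Measure ℝ} [IsProbabilityMeasure μ] {a b : ℝ}
    (h : ∀ᵐ x ∂μ, x ∈ Set.Icc a b) (hab : |b - a| / 2 ≤ σ) :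
    HasSubgaussianMGF (fun x => x - ∫ y, y ∂μ) (σ ^ 2) μ := by
  have h1 := hasSubgaussianMGF_of_mem_Icc (X := fun x : ℝ => x) measurable_id.aemeasurable h
  refine ⟨h1.integrable_exp_mul, fun t => (h1.mgf_le t).trans (Real.exp_le_exp.2 ?_)⟩
  have : ((‖b - a‖₊ / 2) ^ 2 : ℝ≥0) ≤ σ ^ 2 := by
    refine pow_le_pow_left₀ zero_le ?_ 2
    rw [← NNReal.coe_le_coe]
    simpa using hab
  have h2 : (((‖b - a‖₊ / 2) ^ 2 : ℝ≥0) : ℝ) ≤ ((σ ^ 2 : ℝ≥0) : ℝ) := by exact_mod_cast this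
  gcongr

/-- A noiseless arm. -/
noncomputable def ArmLaw.noiseless (σ : ℝ≥0) (m : ℕ → ℝ) (h01 : ∀ n, m n ∈ Set.Icc (0 : ℝ) 1)
    (hr : ∀ n, m n ≤ m (n + 1)) (hc : ∀ n, m (n + 2) - m (n + 1) ≤ m (n + 1) - m n) :
    ArmLaw σ where
  law n := Measure.dirac (m n)
  isProb n := inferInstance
  bounded n := by simpa using h01 n
  subgaussian n := hasSubgaussianMGF_of_mem_Icc_of_le (a := m n) (b := m n)
    (by simp) (by simp)
  rising n _ := by simpa using hr n
  concave n _ := by simpa using hc n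

/-- A stationary arm. -/
def ArmLaw.stationary (ν : Measure ℝ) [IsProbabilityMeasure ν] {a b : ℝ} (ha : 0 ≤ a) (hb : b ≤ 1)
    (hab : |b - a| / 2 ≤ σ) (h : ∀ᵐ x ∂ν, x ∈ Set.Icc a b) : ArmLaw σ where
  law _ := ν
  isProb _ := inferInstance
  bounded _ := h.mono fun _ hx => ⟨ha.trans hx.1, hx.2.trans hb⟩
  subgaussian _ := hasSubgaussianMGF_of_mem_Icc_of_le h hab
  rising _ _ := le_rfl
  concave _ _ := le_rfl

/-- The problem whose arm `0` at every position is `A`, and whose arm `1` at position `j` is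
`A' (v j)`. -/
def cubeProblem {L : ℕ} (A : ArmLaw σ) (A' : Bool → ArmLaw σ) (v : Fin L → Bool) :
    Problem (L * 2) σ :=
  Problem.ofArms fun i =>
    if (finProdFinEquiv.symm i).2 = 0 then A else A' (v (finProdFinEquiv.symm i).1)

section

variable {L : ℕ} (A : ArmLaw σ) (A' : Bool → ArmLaw σ) (v : Fin L → Bool)

theorem cubeProblem_law_zero (j : Fin L) : (cubeProblem A A' v).law (arm j 0) = A.law := by
  simp only [cubeProblem, Problem.ofArms, arm, Equiv.symm_apply_apply]
  rfl

theorem cubeProblem_law_one (j : Fin L) :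
    (cubeProblem A A' v).law (arm j 1) = (A' (v j)).law := by
  simp only [cubeProblem, Problem.ofArms, arm, Equiv.symm_apply_apply]
  rfl

theorem exists_eq_arm (i : Fin (L * 2)) : ∃ j, i = arm j 0 ∨ i = arm j 1 := by
  refine ⟨(finProdFinEquiv.symm i).1, ?_⟩
  have : (finProdFinEquiv.symm i).2 = 0 ∨ (finProdFinEquiv.symm i).2 = 1 := by omega
  rcases this with h | h
  · left; rw [arm, ← h]; exact (Equiv.apply_symm_apply _ _).symm
  · right; rw [arm, ← h]; exact (Equiv.apply_symm_apply _ _).symm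

theorem cubeProblem_mem_constrainedClass {c κ : ℝ}
    (h0 : ∀ n, 1 ≤ n → (∫ x, x ∂(A.law (n + 1))) - ∫ x, x ∂(A.law n) ≤ κ * (n : ℝ) ^ (-c))
    (h1 : ∀ b n, 1 ≤ n →
      (∫ x, x ∂((A' b).law (n + 1))) - ∫ x, x ∂((A' b).law n) ≤ κ * (n : ℝ) ^ (-c)) :
    cubeProblem A A' v ∈ constrainedClass (L * 2) σ c κ := by
  intro i n hn
  obtain ⟨j, rfl | rfl⟩ := exists_eq_arm i
  · simpa only [Problem.increment, Problem.mean, cubeProblem_law_zero] using h0 n hn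
  · simpa only [Problem.increment, Problem.mean, cubeProblem_law_one] using h1 (v j) n hn

end

/-! ### The noiseless construction and the `T ^ (2 - c)` bound. -/

/-- The comparison of two problems may be made for each seed separately. -/
theorem le_integral_add_integral_of_seed (π : Policy K 𝒮) (B B' : Problem K σ) (T : ℕ) (i : Fin K)
    {r : ℝ} (h : ∀ u, r ≤ ∫ x, (π.pulls u x T i : ℝ) ∂B.outcomeLaw +
      ∫ x, ((T : ℝ) - π.pulls u x T i) ∂B'.outcomeLaw) :
    r ≤ ∫ p, (π.pulls p.1 p.2 T i : ℝ) ∂(π.seedLaw.prod B.outcomeLaw) +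
      ∫ p, ((T : ℝ) - π.pulls p.1 p.2 T i) ∂(π.seedLaw.prod B'.outcomeLaw) := by
  have h1 := π.integrable_pulls (π.seedLaw.prod B.outcomeLaw) T i (fun k => (k : ℝ))
  have h2 := π.integrable_pulls (π.seedLaw.prod B'.outcomeLaw) T i (fun k => (T : ℝ) - k)
  rw [integral_prod _ h1, integral_prod _ h2, ← integral_add h1.integral_prod_left
    h2.integral_prod_left]
  calc r = ∫ _, r ∂π.seedLaw := by simp
    _ ≤ _ := integral_mono (integrable_const _)
      (h1.integral_prod_left.add h2.integral_prod_left) h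

theorem Policy.measurable_pulls_cast (π : Policy K 𝒮) (u : ℝ) (t : ℕ) (i : Fin K) :
    Measurable fun x => (π.pulls u x t i : ℝ) := by
  have h := (π.measurable_pulls t i).comp (measurable_prodMk_left (x := u))
  exact (measurable_of_countable (Nat.cast : ℕ → ℝ)).comp h

/-- A policy that cannot tell two noiseless problems apart before pull `m` of arm `i`. -/
theorem noiseless_comparison (π : Policy K 𝒮) (B B' : Problem K σ) (f f' : Fin K × ℕ → ℝ)
    (hB : ∀ i n, B.law i n = Measure.dirac (f (i, n)))
    (hB' : ∀ i n, B'.law i n = Measure.dirac (f' (i, n))) (T m : ℕ) (i : Fin K) (hm : m < T)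
    (h : ∀ i' n, (i' = i → n ≤ m) → f (i', n) = f' (i', n)) (u : ℝ) :
    (m : ℝ) + 1 ≤ ∫ x, (π.pulls u x T i : ℝ) ∂B.outcomeLaw +
      ∫ x, ((T : ℝ) - π.pulls u x T i) ∂B'.outcomeLaw := by
  have e : B.outcomeLaw = Measure.dirac f := by simp [Problem.outcomeLaw, hB]
  have e' : B'.outcomeLaw = Measure.dirac f' := by simp [Problem.outcomeLaw, hB']
  have hmeas := π.measurable_pulls_cast u T i
  have i1 : ∫ x, (π.pulls u x T i : ℝ) ∂B.outcomeLaw = π.pulls u f T i := by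
    rw [e]
    exact integral_dirac' _ _ hmeas.stronglyMeasurable
  have i2 : ∫ x, ((T : ℝ) - π.pulls u x T i) ∂B'.outcomeLaw = T - π.pulls u f' T i := by
    rw [e']
    exact integral_dirac' _ _ (hmeas.const_sub (T : ℝ)).stronglyMeasurable
  rw [i1, i2]
  have hT : (π.pulls u f' T i : ℝ) ≤ T := by exact_mod_cast π.pulls_le u f' T i
  -- With at most `m` pulls the two runs coincide and the two terms add up to `T ≥ m + 1`; otherwise
  -- the first term alone is at least `m + 1`.
  by_cases hc : π.pulls u f T i ≤ m
  · rw [π.pulls_congr u T (x := f) (x' := f') (fun i' n hn => h i' (n + 1) fun e => by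
      subst e; omega) i]
    have : (m : ℝ) + 1 ≤ T := by exact_mod_cast hm
    linarith
  · have : (m : ℝ) + 1 ≤ π.pulls u f T i := by exact_mod_cast not_le.1 hc
    linarith

/-- Arm `1` rises linearly and either stops at pull `T / 4` or goes on to pull `T`; nothing observed
before the stop reveals which. -/
theorem exists_regret_ge_rising {c κ : ℝ} (hc1 : 1 < c) (hκ : 0 < κ) (σ : ℝ≥0) {L T : ℕ}
    (hT : 1 ≤ T) (π : Policy (L * 2) (choiceFamily L)) :
    ∃ B ∈ constrainedClass (L * 2) σ c κ,
      L * (min κ 1 / 64 * (T : ℝ) ^ (2 - c)) ≤ π.regret B T := by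
  have hT1 : (1 : ℝ) ≤ T := by exact_mod_cast hT
  have hT0 : (0 : ℝ) < T := by linarith
  -- The slope allowed at the last pull `T` is allowed at all earlier ones. The cap `1` on the
  -- factor keeps the means within `[0, 1]`, as `s * T ≤ T ^ (1 - c) ≤ 1`.
  set s : ℝ := min κ 1 * (T : ℝ) ^ (-c) with hs
  have hk0 : 0 < min κ 1 := lt_min hκ one_pos
  have hs0 : 0 < s := mul_pos hk0 (Real.rpow_pos_of_pos hT0 _)
  have hsT2 : s * T ^ 2 = min κ 1 * (T : ℝ) ^ (2 - c) := by
    rw [hs, mul_assoc, ← Real.rpow_natCast, ← Real.rpow_add hT0]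
    congr 2
    push_cast
    ring
  have hsT : s * T ≤ 1 := by
    have : s * T = min κ 1 * (T : ℝ) ^ (1 - c) := by
      rw [hs, mul_assoc, ← Real.rpow_add_one hT0.ne']
      congr 2
      ring
    rw [this]
    exact mul_le_one₀ (min_le_right _ _) (Real.rpow_nonneg hT0.le _)
      (Real.rpow_le_one_of_one_le_of_nonpos hT1 (by linarith))
  have hsT0 : 0 < s * T := mul_pos hs0 hT0
  have hsn : ∀ n : ℕ, 1 ≤ n → n ≤ T → s ≤ κ * (n : ℝ) ^ (-c) := by
    intro n h1 h2
    have hn : (0 : ℝ) < n := by exact_mod_cast h1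
    exact mul_le_mul (min_le_left _ _) (Real.rpow_le_rpow_of_nonpos hn (by exact_mod_cast h2)
      (by linarith)) (Real.rpow_nonneg hT0.le _) hκ.le
  -- Halfway between the cap `s * T / 4` of the short ramp and `s * T / 2`, roughly the average of
  -- the full ramp; this leaves a gap of `s * T / 8` on either side.
  set a : ℝ := 3 * (s * T) / 8 with ha
  set N : Bool → ℕ := fun b => if b then T else T / 4 with hN
  have hNT : ∀ b, N b ≤ T := by
    intro b
    cases b <;> simp [hN]
    omega
  set m : Bool → ℕ → ℝ := fun b n => s * (min n (N b) : ℕ) with hm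
  let A : ArmLaw σ := ArmLaw.noiseless σ (fun _ => a) (fun _ => ⟨by positivity, by linarith⟩)
    (fun _ => le_rfl) fun _ => le_rfl
  let A' : Bool → ArmLaw σ := fun b => ArmLaw.noiseless σ (m b)
    (fun n => by
      refine ⟨by positivity, le_trans ?_ hsT⟩
      have : ((min n (N b) : ℕ) : ℝ) ≤ T := by exact_mod_cast (min_le_right _ _).trans (hNT b)
      exact mul_le_mul_of_nonneg_left this hs0.le)
    (fun n => by
      have : ((min n (N b) : ℕ) : ℝ) ≤ (min (n + 1) (N b) : ℕ) := by
        exact_mod_cast (by omega : min n (N b) ≤ min (n + 1) (N b))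
      exact mul_le_mul_of_nonneg_left this hs0.le)
    (fun n => by
      have : ((min (n + 2) (N b) : ℕ) : ℝ) + (min n (N b) : ℕ) ≤
          (min (n + 1) (N b) : ℕ) + (min (n + 1) (N b) : ℕ) := by
        exact_mod_cast (by omega : min (n + 2) (N b) + min n (N b) ≤
          min (n + 1) (N b) + min (n + 1) (N b))
      have := mul_le_mul_of_nonneg_left this hs0.le
      simp only [hm]
      linarith)
  set B : (Fin L → Bool) → Problem (L * 2) σ := cubeProblem A A' with hB
  have hlaw0 : ∀ v j n, (B v).law (arm j 0) n = Measure.dirac a := fun v j n => by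
    rw [hB, cubeProblem_law_zero]; rfl
  have hlaw1 : ∀ v j n, (B v).law (arm j 1) n = Measure.dirac (m (v j) n) := fun v j n => by
    rw [hB, cubeProblem_law_one]; rfl
  have hmean0 : ∀ v j n, (B v).mean (arm j 0) n = a := fun v j n => by
    simp [Problem.mean, hlaw0]
  have hmean1 : ∀ v j n, (B v).mean (arm j 1) n = m (v j) n := fun v j n => by
    simp [Problem.mean, hlaw1]
  have hmem : ∀ v, B v ∈ constrainedClass (L * 2) σ c κ := by
    intro v
    refine cubeProblem_mem_constrainedClass A A' v (fun n hn => ?_) fun b n hn => ?_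
    · simp only [A, ArmLaw.noiseless, integral_dirac, sub_self]
      positivity
    · simp only [A', ArmLaw.noiseless, integral_dirac, hm]
      by_cases h : n < N b
      · rw [min_eq_left h.le, min_eq_left (Nat.succ_le_of_lt h)]
        push_cast
        linarith [hsn n hn (h.le.trans (hNT b))]
      · rw [min_eq_right (not_lt.1 h), min_eq_right ((not_lt.1 h).trans (Nat.le_succ n)), sub_self]
        positivity
  refine (exists_regret_ge π B T (δ := s * T / 8) (r := T / 4) (by positivity) ?_ ?_).elim
    fun v hv => ⟨B v, hmem v, le_trans (le_of_eq ?_) hv⟩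
  · intro v j k hk
    have hkT : (k : ℝ) ≤ T := by exact_mod_cast hk
    simp only [hmean0, hmean1]
    cases hvj : v j
    · simp only [Bool.false_eq_true, if_false, hmean0, Finset.sum_const, Finset.card_range,
        nsmul_eq_mul, Nat.cast_sub hk]
      have h1 : ∑ n ∈ Finset.range k, m false (n + 1) ≤ ∑ _n ∈ Finset.range k, s * (T / 4) := by
        refine Finset.sum_le_sum fun n _ => mul_le_mul_of_nonneg_left ?_ hs0.le
        calc ((min (n + 1) (N false) : ℕ) : ℝ) ≤ (T / 4 : ℕ) := by
              exact_mod_cast min_le_right _ _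
          _ ≤ (T : ℝ) / 4 := Nat.cast_div_le
      rw [Finset.sum_const, Finset.card_range, nsmul_eq_mul] at h1
      rw [ha]
      linarith
    · simp only [if_true, hmean1, hvj, Finset.sum_const, Finset.card_range, nsmul_eq_mul,
        Nat.cast_sub hk]
      have h1 : ∀ k ≤ T, ∑ n ∈ Finset.range k, m true (n + 1) = s * (k * (k + 1) / 2) := by
        intro k
        induction k with
        | zero => simp
        | succ k ih =>
          intro hk
          rw [Finset.sum_range_succ, ih (Nat.le_of_succ_le hk)]
          simp only [hm, hN, if_true, min_eq_left hk]
          push_cast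
          ring
      rw [h1 T le_rfl, h1 k hk, ha]
      -- Exactly the slack in the claimed inequality.
      have : 0 ≤ s * (((T : ℝ) - k) * (k + 1) / 2) := by
        have := sub_nonneg.2 hkT
        positivity
      linarith
  · intro v j hvj
    refine le_integral_add_integral_of_seed π _ _ T _ fun u => ?_
    have hdirac : ∀ v i n, (B v).law i n =
        Measure.dirac ((B v).mean i n) := by
      intro v i n
      obtain ⟨j, rfl | rfl⟩ := exists_eq_arm i
      · simp only [hlaw0, hmean0]
      · simp only [hlaw1, hmean1]
    refine le_trans ?_ (noiseless_comparison π (B v) (B (Function.update v j true))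
      (fun p => (B v).mean p.1 p.2) (fun p => (B (Function.update v j true)).mean p.1 p.2)
      (hdirac v) (hdirac (Function.update v j true)) T (T / 4) (arm j 1) (by omega) ?_ u)
    · have h4 : T ≤ 4 * (T / 4 + 1) := by omega
      generalize T / 4 = q at h4
      have : (T : ℝ) ≤ 4 * (q + 1) := by exact_mod_cast h4
      linarith
    · intro i n hi
      obtain ⟨j', rfl | rfl⟩ := exists_eq_arm i
      · simp only [hmean0]
      · simp only [hmean1]
        by_cases hj : j' = j
        · subst hj
          have h1 := hi rfl
          have h2 : n ≤ T := h1.trans (Nat.div_le_self T 4)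
          rw [hvj, Function.update_self]
          change s * ((min n (T / 4) : ℕ) : ℝ) = s * ((min n T : ℕ) : ℝ)
          rw [min_eq_left h1, min_eq_left h2]
        · rw [Function.update_of_ne hj]
  · linear_combination -(L : ℝ) / 64 * hsT2

/-! ### The stationary construction and the `√T` bound. -/

/-- A policy that cannot tell two stationary problems apart within `T` rounds. -/
theorem stationary_comparison (π : Policy K 𝒮) (B B' : Problem K σ) {T : ℕ} (hT : 1 ≤ T)
    (i : Fin K) (ν : Measure ℝ) [IsProbabilityMeasure ν] {s : ℝ → ℝ} (hs : Measurable s)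
    (hs1 : ∀ y, s y = 1 ∨ s y = -1) {ε : ℝ} (hε0 : 0 ≤ ε) (hε1 : ε ≤ 1)
    (hB : ∀ n, B.law i n = ν.withDensity fun y => ENNReal.ofReal (1 - ε * s y))
    (hB' : ∀ n, B'.law i n = ν.withDensity fun y => ENNReal.ofReal (1 + ε * s y))
    (hne : ∀ i' ≠ i, ∀ n, B.law i' n = B'.law i' n) (u : ℝ) :
    T * ((1 - ε ^ 2) ^ T / 2) ≤ ∫ x, (π.pulls u x T i : ℝ) ∂B.outcomeLaw +
      ∫ x, ((T : ℝ) - π.pulls u x T i) ∂B'.outcomeLaw := by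
  have hT0 : (0 : ℝ) < T := by exact_mod_cast hT
  set F : Finset (Fin K × ℕ) := (Finset.Icc 1 T).image fun n => (i, n) with hF
  have hFi : ∀ p ∈ F, p.1 = i := by
    intro p hp
    obtain ⟨n, -, rfl⟩ := Finset.mem_image.1 hp
    rfl
  have hcard : F.card = T := by
    rw [hF, Finset.card_image_of_injective _ fun _ _ h => (Prod.mk.inj h).2]
    simp
  let μ : Fin K × ℕ → Measure ℝ := fun p => if p ∈ F then ν else B.law p.1 p.2
  -- The law is changed only at pulls `1, …, T` of arm `i`, so that the likelihood ratio is a finite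
  -- product; later pulls do not affect the first `T` rounds (`hcongr`).
  let μ' : Fin K × ℕ → Measure ℝ := fun p => if p ∈ F then B'.law p.1 p.2 else B.law p.1 p.2
  have i1 : ∀ p, IsProbabilityMeasure (μ p) := by
    intro p; simp only [μ]; split_ifs <;> infer_instance
  have i2 : ∀ p, IsProbabilityMeasure (μ' p) := by
    intro p; simp only [μ']; split_ifs <;> infer_instance
  have hmeas := π.measurable_pulls_cast u T i
  have hle : ∀ x, (π.pulls u x T i : ℝ) ≤ T := fun x => by exact_mod_cast π.pulls_le u x T i
  have key := testing_lower_bound μ (fun p : Fin K × ℕ => B.law p.1 p.2) μ' F hs hs1 hε0 hε1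
    (fun p hp => by simp only [μ, hp, if_true, hFi p hp, hB])
    (fun p hp => by simp only [μ, μ', hp, if_true, hFi p hp, hB'])
    (fun p hp => by simp only [μ, hp, if_false]) (fun p hp => by simp only [μ, μ', hp, if_false])
    -- The fraction of rounds spent on arm `i` serves as a randomized test.
    (f := fun x => (π.pulls u x T i : ℝ) / T) (hmeas.div_const _) (fun x => by positivity)
    (fun x => (div_le_one hT0).2 (hle x))
  have hcongr : ∫ x, ((T : ℝ) - π.pulls u x T i) ∂(Measure.infinitePi μ') =
      ∫ x, ((T : ℝ) - π.pulls u x T i) ∂B'.outcomeLaw := by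
    refine integral_infinitePi_congr μ' (fun p : Fin K × ℕ => B'.law p.1 p.2)
      (Finset.univ ×ˢ Finset.Icc 1 T) (fun p hp => ?_) (hmeas.const_sub (T : ℝ))
      fun x y hxy => ?_
    · by_cases hpF : p ∈ F
      · simp only [μ', hpF, if_true]
      · simp only [μ', hpF, if_false]
        refine hne _ (fun h => hpF ?_) _
        exact Finset.mem_image.2 ⟨p.2, (Finset.mem_product.1 hp).2, by rw [← h]⟩
    · rw [π.pulls_congr u T fun i' n hn => hxy _ ?_]
      have := π.pulls_le u x T i'
      simp
      omega
  have e1 : ∫ x, (π.pulls u x T i : ℝ) / T ∂(Measure.infinitePi fun p : Fin K × ℕ =>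
      B.law p.1 p.2) = (∫ x, (π.pulls u x T i : ℝ) ∂B.outcomeLaw) / T := integral_div _ _
  have e2 : ∫ x, (1 - (π.pulls u x T i : ℝ) / T) ∂(Measure.infinitePi μ') =
      (∫ x, ((T : ℝ) - π.pulls u x T i) ∂B'.outcomeLaw) / T := by
    rw [← hcongr, ← integral_div]
    congr 1
    funext x
    field_simp
  rw [hcard, e1, e2, ← add_div, le_div_iff₀ hT0] at key
  linarith

/-- The fair law on two points around `1 / 2`. -/
noncomputable def twoPoint (η : ℝ) : Measure ℝ :=
  (2⁻¹ : ENNReal) • Measure.dirac (1 / 2 - η) + (2⁻¹ : ENNReal) • Measure.dirac (1 / 2 + η)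

/-- The side of `1 / 2` on which a real number lies. -/
noncomputable def side (y : ℝ) : ℝ := if 1 / 2 ≤ y then 1 else -1

/-- The law `twoPoint η` tilted by `e`. -/
noncomputable def tiltedTwoPoint (η e : ℝ) : Measure ℝ :=
  (twoPoint η).withDensity fun y => ENNReal.ofReal (1 + e * side y)

theorem side_eq (y : ℝ) : side y = 1 ∨ side y = -1 := by
  unfold side; split_ifs <;> simp

theorem measurable_side : Measurable side :=
  Measurable.ite measurableSet_Ici measurable_const measurable_const

theorem side_add {η : ℝ} (hη : 0 < η) : side (1 / 2 + η) = 1 := if_pos (by linarith)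

theorem side_sub {η : ℝ} (hη : 0 < η) : side (1 / 2 - η) = -1 := if_neg (by linarith)

instance (η : ℝ) : IsProbabilityMeasure (twoPoint η) :=
  ⟨by simp [twoPoint, ENNReal.inv_two_add_inv_two]⟩

theorem one_add_mul_side_nonneg {e : ℝ} (he : |e| ≤ 1) (y : ℝ) : 0 ≤ 1 + e * side y := by
  rw [abs_le] at he
  rcases side_eq y with h | h <;> rw [h] <;> linarith [he.1, he.2]

theorem isProbabilityMeasure_tiltedTwoPoint {η e : ℝ} (hη : 0 < η) (he : |e| ≤ 1) :
    IsProbabilityMeasure (tiltedTwoPoint η e) := by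
  have h := abs_le.1 he
  constructor
  rw [tiltedTwoPoint, withDensity_apply _ .univ, setLIntegral_univ, twoPoint,
    lintegral_add_measure, lintegral_smul_measure, lintegral_smul_measure, lintegral_dirac,
    lintegral_dirac, side_add hη, side_sub hη, ← smul_add, ← ENNReal.ofReal_add (by linarith)
    (by linarith), show (1 + e * -1 + (1 + e * 1) : ℝ) = 2 by ring]
  simpa using ENNReal.inv_mul_cancel (by simp) (by simp)

theorem integral_tiltedTwoPoint {η e : ℝ} (hη : 0 < η) (he : |e| ≤ 1) :
    ∫ y, y ∂(tiltedTwoPoint η e) = 1 / 2 + e * η := by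
  have hm : Measurable fun y => 1 + e * side y := (measurable_side.const_mul e).const_add 1
  have hi : ∀ a : ℝ, Integrable (fun y => (1 + e * side y) * y)
      ((2⁻¹ : ENNReal) • Measure.dirac a) := fun a =>
    (integrable_dirac' (hm.mul measurable_id).stronglyMeasurable enorm_lt_top).smul_measure (by simp)
  rw [tiltedTwoPoint, integral_withDensity_eq_integral_toReal_smul hm.ennreal_ofReal
    (Filter.Eventually.of_forall fun _ => ENNReal.ofReal_lt_top)]
  simp only [ENNReal.toReal_ofReal (one_add_mul_side_nonneg he _), smul_eq_mul]
  rw [twoPoint, integral_add_measure (hi _) (hi _), integral_smul_measure, integral_smul_measure,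
    integral_dirac, integral_dirac, side_add hη, side_sub hη]
  simp only [ENNReal.toReal_inv, ENNReal.toReal_ofNat, smul_eq_mul]
  ring

theorem ae_tiltedTwoPoint_mem {η e : ℝ} (hη : 0 < η) :
    ∀ᵐ y ∂(tiltedTwoPoint η e), y ∈ Set.Icc (1 / 2 - η) (1 / 2 + η) := by
  suffices h : ∀ᵐ y ∂(twoPoint η), y ∈ Set.Icc (1 / 2 - η) (1 / 2 + η) from
    (withDensity_absolutelyContinuous _ _).ae_le h
  rw [twoPoint, ae_add_measure_iff]
  constructor
  · refine Measure.ae_smul_measure ?_ _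
    exact (ae_dirac_iff measurableSet_Icc).2 ⟨le_rfl, by linarith⟩
  · refine Measure.ae_smul_measure ?_ _
    exact (ae_dirac_iff measurableSet_Icc).2 ⟨by linarith, le_rfl⟩

/-- Arm `1` has constant mean `1 / 2 ± ε * η` against `1 / 2` for arm `0`; all increments vanish, so
every `c` is admissible. -/
theorem exists_regret_ge_stationary {c κ : ℝ} (hκ : 0 < κ) (hσ : 0 < σ) {L T : ℕ}
    (hT : 1 ≤ T) (π : Policy (L * 2) (choiceFamily L)) :
    ∃ B ∈ constrainedClass (L * 2) σ c κ,
      L * (min (σ : ℝ) (1 / 2) * 3 / 32 * √T) ≤ π.regret B T := by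
  have hT1 : (1 : ℝ) ≤ T := by exact_mod_cast hT
  have hT0 : (0 : ℝ) < T := by linarith
  -- Half-width of the support: at most `σ` for Hoeffding's lemma, at most `1 / 2` to stay in `[0,
  -- 1]`.
  set η : ℝ := min (σ : ℝ) (1 / 2) with hηd
  have hη : 0 < η := lt_min (by exact_mod_cast hσ) (by norm_num)
  have hη2 : η ≤ 1 / 2 := min_le_right _ _
  have hησ : η ≤ σ := min_le_left _ _
  have hsq : 1 ≤ √(T : ℝ) := Real.one_le_sqrt.2 hT1
  have hsqT : √(T : ℝ) ^ 2 = T := Real.sq_sqrt hT0.le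
  -- Chosen so that `T * ε ^ 2 = 1 / 4`; Bernoulli's inequality then gives `(1 - ε ^ 2) ^ T ≥ 3 /
  -- 4`, whence `r = T * (3 / 8)`.
  set ε : ℝ := 1 / (2 * √T) with hε
  have hε0 : 0 < ε := by positivity
  have hε1 : ε ≤ 1 := by rw [hε, div_le_one (by positivity)]; linarith
  have hε2 : (T : ℝ) * ε ^ 2 = 1 / 4 := by
    rw [hε, div_pow, mul_pow, hsqT]; field_simp; norm_num
  let e : Bool → ℝ := fun b => if b then ε else -ε
  have he : ∀ b, |e b| ≤ 1 := by
    intro b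
    cases b <;> simp [e, abs_of_pos hε0, hε1]
  have hprob : ∀ b, IsProbabilityMeasure (tiltedTwoPoint η (e b)) := fun b =>
    isProbabilityMeasure_tiltedTwoPoint hη (he b)
  let A : ArmLaw σ := ArmLaw.noiseless σ (fun _ => 1 / 2) (fun _ => by norm_num)
    (fun _ => le_rfl) fun _ => le_rfl
  let A' : Bool → ArmLaw σ := fun b => ArmLaw.stationary (tiltedTwoPoint η (e b))
    (a := 1 / 2 - η) (b := 1 / 2 + η) (by linarith) (by linarith)
    (by rw [show 1 / 2 + η - (1 / 2 - η) = 2 * η by ring, abs_of_pos (by linarith)]; linarith)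
    (ae_tiltedTwoPoint_mem hη)
  set B : (Fin L → Bool) → Problem (L * 2) σ := cubeProblem A A' with hB
  have hlaw0 : ∀ v j n, (B v).law (arm j 0) n = Measure.dirac (1 / 2) := fun v j n => by
    rw [hB, cubeProblem_law_zero]; rfl
  have hlaw1 : ∀ v j n, (B v).law (arm j 1) n = tiltedTwoPoint η (e (v j)) := fun v j n => by
    rw [hB, cubeProblem_law_one]; rfl
  have hmean0 : ∀ v j n, (B v).mean (arm j 0) n = 1 / 2 := fun v j n => by
    simp [Problem.mean, hlaw0]
  have hmean1 : ∀ v j n, (B v).mean (arm j 1) n = 1 / 2 + e (v j) * η := fun v j n => by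
    rw [Problem.mean, hlaw1, integral_tiltedTwoPoint hη (he _)]
  have hmem : ∀ v, B v ∈ constrainedClass (L * 2) σ c κ := by
    intro v
    refine cubeProblem_mem_constrainedClass A A' v (fun n hn => ?_) fun b n hn => ?_
    · simp only [A, ArmLaw.noiseless, sub_self]
      positivity
    · simp only [A', ArmLaw.stationary, sub_self]
      positivity
  refine (exists_regret_ge π B T (δ := η * ε) (r := T * (3 / 8)) (by positivity) ?_ ?_).elim
    fun v hv => ⟨B v, hmem v, le_trans (le_of_eq ?_) hv⟩
  · intro v j k hk
    cases hvj : v j <;>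
    simp only [hmean0, hmean1, hvj, e, if_true, if_false, Bool.false_eq_true, Finset.sum_const,
      Finset.card_range, nsmul_eq_mul, Nat.cast_sub hk] <;>
    linarith
  · intro v j hvj
    refine le_integral_add_integral_of_seed π _ _ T _ fun u => ?_
    refine le_trans ?_ (stationary_comparison π (B v) (B (Function.update v j true)) hT (arm j 1)
      (twoPoint η) measurable_side side_eq hε0.le hε1 (fun n => ?_) (fun n => ?_)
      (fun i hi n => ?_) u)
    · have hb := one_add_mul_le_pow (a := -ε ^ 2) (by nlinarith) T
      have : (3 : ℝ) / 4 ≤ (1 - ε ^ 2) ^ T := by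
        calc (3 : ℝ) / 4 = 1 + T * (-ε ^ 2) := by linarith
          _ ≤ (1 + -ε ^ 2) ^ T := hb
          _ = (1 - ε ^ 2) ^ T := by ring
      exact mul_le_mul_of_nonneg_left (by linarith) hT0.le
    · simp only [hlaw1, hvj, e, tiltedTwoPoint, Bool.false_eq_true, if_false, neg_mul,
        sub_eq_add_neg]
    · simp only [hlaw1, Function.update_self, e, tiltedTwoPoint, if_true]
    · obtain ⟨j', rfl | rfl⟩ := exists_eq_arm i
      · rw [hlaw0, hlaw0]
      · have hj : j' ≠ j := fun h => hi (by rw [h])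
        rw [hlaw1, hlaw1, Function.update_of_ne hj]
  · have : ε * T = √T / 2 := by
      rw [hε]; field_simp; linarith
    linear_combination -(L : ℝ) * η * 3 / 16 * this

end RisingBandit

open RisingBandit in
theorem mainTheorem4 (c : ℝ) (hc1 : 1 < c) (hc2 : c < 2) (κ : ℝ) (hκ : 0 < κ)
    (σ : NNReal) (hσ : 0 < σ) :
    ∃ C : ℝ, 0 < C ∧ ∀ L : ℕ, 1 ≤ L →
      ∃ (K : ℕ) (𝒮 : Finset (Finset (Fin K))),
        (∀ S ∈ 𝒮, S.card ≤ L) ∧ (∃ S ∈ 𝒮, S.card = L) ∧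
        ∀ T : ℕ, 1 ≤ T → ∀ π : Policy K 𝒮, ∃ B ∈ constrainedClass K σ c κ,
          C * max ((L : ℝ) * √(T : ℝ)) ((L : ℝ) * (T : ℝ) ^ (2 - c)) ≤ π.regret B T := by
  have hσ' : (0 : ℝ) < σ := by exact_mod_cast hσ
  refine ⟨min (min κ 1 / 64) (min (σ : ℝ) (1 / 2) * 3 / 32), by positivity, fun L _ =>
    ⟨L * 2, choiceFamily L, fun S hS => ?_, ⟨_, choiceArm_mem fun _ => 0, card_choiceArm _⟩,
      fun T hT π => ?_⟩⟩
  · obtain ⟨f, -, rfl⟩ := Finset.mem_image.1 hS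
    exact (card_choiceArm f).le
  · rcases le_total ((L : ℝ) * √(T : ℝ)) ((L : ℝ) * (T : ℝ) ^ (2 - c)) with h | h
    · obtain ⟨B, hB, hr⟩ := exists_regret_ge_rising hc1 hκ σ hT π
      refine ⟨B, hB, le_trans ?_ hr⟩
      rw [max_eq_right h, mul_left_comm]
      gcongr
      exact min_le_left _ _
    · obtain ⟨B, hB, hr⟩ := exists_regret_ge_stationary (c := c) hκ hσ hT π
      refine ⟨B, hB, le_trans ?_ hr⟩
      rw [max_eq_left h, mul_left_comm]
      gcongr
      exact min_le_right _ _
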